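/- Let $n$ be a positive integer and let $G$ be a simple undirected graph on $n$ vertices. Write $\rho(G)$ for the spectral radius of $G$, that is, the largest modulus of an eigenvalue of its adjacency matrix, and let $T_{n,2}$ be the complete bipartite graph on $n$ vertices whose parts have sizes $\lfloor n/2\rfloor$ and $\lceil n/2\rceil$. If $\rho(G)>\rho(T_{n,2})$, then $G$ contains a cycle of length $t$ for every integer $t$ with $3\le t\le \frac{n}{7}$. -/

import Mathlib

/-- The spectral radius `ρ(G)` of a finite graph: the largest modulus of the eigenvalues of its
adjacency matrix. The matrix is real symmetric, so all of its eigenvalues are real. -/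
noncomputable def SimpleGraph.specRadius {V : Type*} [Fintype V] [DecidableEq V]
    (G : SimpleGraph V) [DecidableRel G.Adj] : ENNReal :=
  spectralRadius ℝ (G.adjMatrix ℝ)

/-- `G` contains a cycle of length `t` (as a not necessarily induced subgraph). -/
def SimpleGraph.ContainsCycleOfLength {V : Type*} (G : SimpleGraph V) (t : ℕ) : Prop :=
  ∃ (v : V) (p : G.Walk v v), p.IsCycle ∧ p.length = t

/-! Comparing an eigenvector at its entry of largest modulus, at `u`, with its second iterate bounds
the squared eigenvalue by the number of 2-walks from `u`, the degree sum over `N(u)`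
(`exists_sq_le_edgeCount`). So some `u` has degree sum above `⌊n/2⌋⌈n/2⌉`. Without a `t`-cycle this
sum is at most `n²/4` (`four_mul_edgeCount_neighbors_le`): no path on `t - 1` vertices avoiding `u`
has both ends in `N(u)`. Erdős–Gallai makes `N(u)` sparse. Between `N(u)` and the remaining
vertices, a core `(X, Y)` of large minimum degree carries all but linearly many edges; its long
alternating paths forbid edges from `X` to `N(u)`. What remains is essentially `4ab ≤ (a + b)²`. -/

namespace SimpleGraph

open Finset

/-! ### Edge counts and cores of bipartite pairs -/

section Counting

variable {V : Type*} (G : SimpleGraph V) [DecidableRel G.Adj]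

/-- The number of neighbours of `v` in `T`. -/
def degIn (v : V) (T : Finset V) : ℕ := #{w ∈ T | G.Adj v w}

/-- The number of ordered pairs `(v, w)` with `v ∈ S`, `w ∈ T` and `v` adjacent to `w`. -/
def edgeCount (S T : Finset V) : ℕ := ∑ v ∈ S, G.degIn v T

lemma degIn_le_card (v : V) (T : Finset V) : G.degIn v T ≤ #T := card_filter_le _ _

lemma edgeCount_comm (S T : Finset V) : G.edgeCount S T = G.edgeCount T S := by
  simp only [edgeCount, degIn, card_filter]
  rw [sum_comm]
  simp only [G.adj_comm]

lemma edgeCount_le_mul (S T : Finset V) : G.edgeCount S T ≤ #S * #T := by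
  simpa [edgeCount] using sum_le_card_nsmul S _ _ fun v _ ↦ G.degIn_le_card v T

lemma edgeCount_eq_zero {S T : Finset V} (h : ∀ v ∈ S, ∀ w ∈ T, ¬ G.Adj v w) :
    G.edgeCount S T = 0 := by
  refine sum_eq_zero fun v hv ↦ ?_
  simpa [degIn, filter_eq_empty_iff] using h v hv

variable [DecidableEq V]

lemma degIn_le_card_pred {v : V} {T : Finset V} (h : v ∈ T) : G.degIn v T ≤ #T - 1 := by
  rw [← card_erase_of_mem h]
  refine card_le_card fun w hw ↦ ?_
  rw [mem_filter] at hw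
  exact mem_erase.2 ⟨hw.2.ne', hw.1⟩

lemma edgeCount_sdiff_left {S S' : Finset V} (h : S' ⊆ S) (T : Finset V) :
    G.edgeCount S T = G.edgeCount S' T + G.edgeCount (S \ S') T := by
  rw [edgeCount, ← sum_sdiff h, add_comm]; rfl

lemma edgeCount_sdiff_right (S : Finset V) {T T' : Finset V} (h : T' ⊆ T) :
    G.edgeCount S T = G.edgeCount S T' + G.edgeCount S (T \ T') := by
  rw [edgeCount_comm, edgeCount_sdiff_left G h, edgeCount_comm, G.edgeCount_comm (T \ T')]

lemma edgeCount_erase_left {S : Finset V} {v : V} (h : v ∈ S) (T : Finset V) :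
    G.edgeCount S T = G.edgeCount (S.erase v) T + G.degIn v T :=
  (sum_erase_add S _ h).symm

lemma edgeCount_erase_right (S : Finset V) {T : Finset V} {v : V} (h : v ∈ T) :
    G.edgeCount S T = G.edgeCount S (T.erase v) + G.degIn v S := by
  rw [edgeCount_comm, edgeCount_erase_left G h, edgeCount_comm]

lemma degIn_erase_self (v : V) (S : Finset V) : G.degIn v (S.erase v) = G.degIn v S := by
  unfold degIn
  congr 1
  ext w
  simp only [mem_filter, mem_erase]
  exact ⟨fun h ↦ ⟨h.1.2, h.2⟩, fun h ↦ ⟨⟨h.2.ne', h.1⟩, h.2⟩⟩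

lemma edgeCount_erase_erase {S : Finset V} {v : V} (h : v ∈ S) :
    G.edgeCount S S = G.edgeCount (S.erase v) (S.erase v) + 2 * G.degIn v S := by
  rw [edgeCount_erase_left G h, edgeCount_erase_right G _ h, degIn_erase_self]
  ring

lemma edgeCount_self_of_not_adj {S T : Finset V} (hTS : T ⊆ S)
    (h : ∀ v ∈ T, ∀ w ∈ S \ T, ¬ G.Adj v w) :
    G.edgeCount S S = G.edgeCount T T + G.edgeCount (S \ T) (S \ T) := by
  rw [edgeCount_sdiff_left G hTS, edgeCount_sdiff_right G T hTS,
    edgeCount_sdiff_right G (S \ T) hTS, G.edgeCount_comm (S \ T) T, G.edgeCount_eq_zero h]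
  ring

/-- In a bipartite pair `(X, Y)` one can discard vertices of degree at most `k` until all the
remaining degrees exceed `k`. -/
lemma exists_core (k : ℕ) (X Y : Finset V) :
    ∃ X' ⊆ X, ∃ Y' ⊆ Y, (∀ x ∈ X', k < G.degIn x Y') ∧ (∀ y ∈ Y', k < G.degIn y X') ∧
      G.edgeCount X Y + k * (#X' + #Y') ≤ k * (#X + #Y) + G.edgeCount X' Y' := by
  induction hs : #X + #Y generalizing X Y with
  | zero =>
    rw [Nat.add_eq_zero_iff, card_eq_zero, card_eq_zero] at hs
    obtain ⟨rfl, rfl⟩ := hs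
    exact ⟨∅, Subset.rfl, ∅, Subset.rfl, by simp⟩
  | succ s ih =>
    -- Each deletion loses at most `k` edges, paid for by the one vertex removed.
    by_cases hX : ∃ x ∈ X, G.degIn x Y ≤ k
    · obtain ⟨x, hx, hxk⟩ := hX
      have hc := card_erase_add_one hx
      obtain ⟨X', hX', Y', hY', h1, h2, h3⟩ := ih (X.erase x) Y (by omega)
      refine ⟨X', hX'.trans (erase_subset _ _), Y', hY', h1, h2, ?_⟩
      rw [edgeCount_erase_left G hx, ← hs]
      have : s = #(X.erase x) + #Y := by omega
      rw [← hc]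
      rw [this] at h3
      linarith
    by_cases hY : ∃ y ∈ Y, G.degIn y X ≤ k
    · obtain ⟨y, hy, hyk⟩ := hY
      have hc := card_erase_add_one hy
      obtain ⟨X', hX', Y', hY', h1, h2, h3⟩ := ih X (Y.erase y) (by omega)
      refine ⟨X', hX', Y', hY'.trans (erase_subset _ _), h1, h2, ?_⟩
      rw [edgeCount_erase_right G _ hy, ← hs]
      have : s = #X + #(Y.erase y) := by omega
      rw [← hc]
      rw [this] at h3
      linarith
    push Not at hX hY
    exact ⟨X, Subset.rfl, Y, Subset.rfl, hX, hY, by rw [hs]; linarith⟩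

end Counting

/-! ### Paths, closed chains and Erdős–Gallai -/

section Paths

variable {V : Type*}

/-- Pigeonhole: there are only `l.length - 1` consecutive pairs, so one is counted by both `P` and
`Q`. -/
lemma _root_.List.exists_split_of_le_countP {α : Type*} (P Q : α → Bool) (l : List α)
    (hl : l ≠ []) (h : l.length ≤ l.tail.countP P + l.dropLast.countP Q) :
    ∃ l₁ x y l₂, l = l₁ ++ x :: y :: l₂ ∧ Q x ∧ P y := by
  induction l with
  | nil => exact absurd rfl hl
  | cons x l ih =>
    cases l with
    | nil => simp at h
    | cons y l =>
      by_cases hxy : Q x ∧ P y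
      · exact ⟨[], x, y, l, rfl, hxy⟩
      · obtain ⟨l₁, a, b, l₂, h1, h2⟩ := ih (by simp) (by
          simp only [List.tail_cons, List.dropLast_cons_cons, List.countP_cons,
            List.length_cons] at h ⊢
          split_ifs at h <;> first | omega | (exfalso; tauto))
        exact ⟨x :: l₁, a, b, l₂, by rw [h1]; rfl, h2⟩

variable {G : SimpleGraph V}

/-- Rotating a closed chain to start at `z` lets `y` be prepended. This contradicts maximality of a
path in Erdős–Gallai. -/
lemma exists_isChain_longer {c₁ c₂ : List V} {y z : V}
    (hc : (c₁ ++ z :: c₂).IsChain G.Adj)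
    (hclosed : ∀ a ∈ (c₁ ++ z :: c₂).getLast?, ∀ b ∈ (c₁ ++ z :: c₂).head?, G.Adj a b)
    (hy : G.Adj y z) : (y :: z :: (c₂ ++ c₁)).IsChain G.Adj := by
  rw [List.isChain_append] at hc
  refine List.isChain_cons_cons.2 ⟨hy, ?_⟩
  have : (z :: c₂ ++ c₁).IsChain G.Adj := by
    refine List.IsChain.append hc.2.1 hc.1 fun a ha b hb ↦ hclosed a ?_ b ?_
    · simp only [Option.mem_def] at ha ⊢
      rw [List.getLast?_append, ha]; rfl
    · simp only [Option.mem_def] at hb ⊢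
      rw [List.head?_append, hb]; rfl
  simpa using this

/-- Crossing chords between the ends of a path turn it into a cycle on the same vertices. -/
lemma isChain_crossing {l₁ l₂ : List V} {x y a b : V}
    (hc : (l₁ ++ x :: y :: l₂).IsChain G.Adj)
    (ha : (l₁ ++ x :: y :: l₂).head? = some a) (hb : (l₁ ++ x :: y :: l₂).getLast? = some b)
    (hay : G.Adj a y) (hbx : G.Adj b x) :
    ((l₁ ++ [x]) ++ (y :: l₂).reverse).IsChain G.Adj ∧
      ∀ u ∈ ((l₁ ++ [x]) ++ (y :: l₂).reverse).getLast?,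
      ∀ v ∈ ((l₁ ++ [x]) ++ (y :: l₂).reverse).head?, G.Adj u v := by
  rw [List.isChain_append_cons_cons] at hc
  have hb' : (y :: l₂).getLast? = some b := by
    rw [List.getLast?_append] at hb
    simpa [List.getLast?_cons_cons] using hb
  have ha' : (l₁ ++ [x]).head? = some a := by
    cases l₁ <;> simpa using ha
  constructor
  · refine List.IsChain.append hc.1 ?_ ?_
    · rw [List.isChain_reverse]
      exact hc.2.2.imp fun _ _ h ↦ h.symm
    · intro u hu v hv
      rw [List.head?_reverse, hb'] at hv
      simp only [List.getLast?_append, List.getLast?_singleton, Option.some_or,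
        Option.mem_def, Option.some.injEq] at hu hv
      subst hu hv
      exact hbx.symm
  · intro u hu v hv
    rw [List.head?_append, ha'] at hv
    rw [List.getLast?_append] at hu
    simp only [List.getLast?_reverse, List.head?_cons, Option.some_or,
      Option.mem_def, Option.some.injEq] at hu hv
    subst hu hv
    exact hay.symm

/-- A path on `t - 1` vertices between two neighbours of an outside vertex gives a `t`-cycle. -/
lemma containsCycleOfLength_of_isChain {u x z : V} {l : List V} (hch : (x :: l).IsChain G.Adj)
    (hnd : (x :: l).Nodup) (hz : (x :: l).getLast? = some z) (hux : G.Adj u x) (huz : G.Adj u z)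
    (hu : u ∉ x :: l) (hl : 1 ≤ l.length) : G.ContainsCycleOfLength (l.length + 2) := by
  have hz' : (x :: l).getLast (by simp) = z := by
    rw [List.getLast?_eq_some_getLast (by simp)] at hz
    exact Option.some.inj hz
  obtain ⟨q, hq⟩ : ∃ q : G.Walk x z, q.support = x :: l := by
    subst hz'
    exact ⟨Walk.ofSupport (x :: l) (by simp) hch, Walk.support_ofSupport _ hch⟩
  have hqlen : q.length = l.length := by
    have := q.length_support
    rw [hq, List.length_cons] at this
    omega
  have hxz : x ≠ z := by
    rintro rfl
    rw [← hz'] at hnd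
    obtain ⟨y, l', rfl⟩ := List.exists_cons_of_length_pos hl
    rw [List.getLast_cons (by simp)] at hnd
    exact (List.nodup_cons.1 hnd).1 (List.getLast_mem _)
  refine ⟨x, q.append (Walk.cons huz.symm (Walk.cons hux Walk.nil)), ?_, ?_⟩
  · refine Walk.IsPath.isCycle_append ?_ ?_ ?_ ?_
    · rw [Walk.isPath_def, hq]; exact hnd
    · simp [Walk.isPath_def, huz.ne', hux.ne, hxz.symm]
    · rw [hq]
      have h1 := (List.nodup_cons.1 hnd).1
      have h2 : u ∉ l := fun h ↦ hu (List.mem_cons_of_mem _ h)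
      simp [h1, h2]
    · right; simp
  · simp [hqlen]

variable [DecidableEq V] [DecidableRel G.Adj]

lemma degIn_le_countP {v : V} {S : Finset V} {l : List V}
    (h : ∀ w ∈ S, G.Adj v w → w ∈ l) : G.degIn v S ≤ l.countP (G.Adj v ·) := by
  rw [List.countP_eq_length_filter]
  refine (card_le_card fun w hw ↦ ?_).trans (List.toFinset_card_le _)
  rw [mem_filter] at hw
  simpa using ⟨h w hw.1 hw.2, hw.2⟩

/-- The Erdős–Gallai theorem for paths: a set of vertices carrying no path on `m + 2` vertices
spans at most `m * #S / 2` edges. -/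
theorem edgeCount_le_of_no_path (m : ℕ) (S : Finset V)
    (h : ∀ l : List V, l.IsChain G.Adj → l.Nodup → (∀ v ∈ l, v ∈ S) → l.length < m + 2) :
    G.edgeCount S S ≤ m * #S := by
  induction hs : #S using Nat.strong_induction_on generalizing S with
  | _ s ih =>
    subst hs
    -- Ordered pairs count each edge twice, so deleting such a vertex costs at most `m`.
    by_cases hlow : ∃ v ∈ S, 2 * G.degIn v S ≤ m
    · obtain ⟨v, hv, hvm⟩ := hlow
      have hc := card_erase_add_one hv
      have := ih _ (by omega) (S.erase v)
        (fun l h1 h2 h3 ↦ h l h1 h2 fun w hw ↦ mem_of_mem_erase (h3 w hw)) rfl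
      rw [edgeCount_erase_erase G hv, ← hc]
      linarith
    push Not at hlow
    obtain rfl | ⟨v₀, hv₀⟩ := S.eq_empty_or_nonempty
    · simp [edgeCount]
    let P : ℕ → Prop := fun j ↦ ∃ l : List V, l.IsChain G.Adj ∧ l.Nodup ∧ (∀ v ∈ l, v ∈ S) ∧
      l.length = j
    have hP1 : P 1 := ⟨[v₀], by simp, by simp, by simpa using hv₀, rfl⟩
    have hPb : ∀ j, P j → j ≤ m + 1 := by
      rintro j ⟨l, h1, h2, h3, rfl⟩
      have := h l h1 h2 h3
      omega
    obtain ⟨p, ⟨l, hch, hnd, hlS, hlen⟩, hp1, hmax⟩ :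
        ∃ p, P p ∧ 1 ≤ p ∧ ∀ j, P j → j ≤ p := by
      classical
      exact ⟨Nat.findGreatest P (m + 1), Nat.findGreatest_spec (by omega) hP1,
        Nat.le_findGreatest (by omega) hP1, fun j hj ↦ Nat.le_findGreatest (hPb j hj) hj⟩
    have hpm : p ≤ m + 1 := hPb p ⟨l, hch, hnd, hlS, hlen⟩
    have hne : l ≠ [] := by rintro rfl; simp at hlen; omega
    obtain ⟨a, l', rfl⟩ := List.exists_cons_of_ne_nil hne
    -- The path is longest, so all neighbours of its ends within `S` lie on it.
    have hA : G.degIn a S ≤ (a :: l').tail.countP (G.Adj a ·) := by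
      refine degIn_le_countP fun w hw haw ↦ ?_
      by_contra hwl
      have := hmax (p + 1) ⟨w :: a :: l', List.isChain_cons_cons.2 ⟨haw.symm, hch⟩, ?_, ?_, ?_⟩
      · omega
      · refine List.nodup_cons.2 ⟨?_, hnd⟩
        rintro (_ | _)
        · exact haw.ne rfl
        · exact hwl (by simpa)
      · intro v hv
        rcases List.mem_cons.1 hv with rfl | hv
        exacts [hw, hlS v hv]
      · simp at hlen ⊢; omega
    obtain ⟨l'', b, hlb⟩ : ∃ l'' b, a :: l' = l'' ++ [b] :=
      ⟨_, _, (List.dropLast_append_getLast hne).symm⟩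
    have hB : G.degIn b S ≤ (a :: l').dropLast.countP (G.Adj b ·) := by
      refine degIn_le_countP fun w hw hbw ↦ ?_
      by_contra hwl
      rw [hlb] at hwl hch hnd hlS hlen
      rw [List.dropLast_concat] at hwl
      have hwl' : w ∉ l'' ++ [b] := by
        simp [hwl, hbw.ne']
      have := hmax (p + 1) ⟨(l'' ++ [b]) ++ [w], ?_, ?_, ?_, ?_⟩
      · omega
      · refine hch.append (by simp) ?_
        simpa using hbw
      · refine List.nodup_append'.2 ⟨hnd, by simp, ?_⟩
        simpa using hwl'
      · intro v hv
        rcases List.mem_append.1 hv with hv | hv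
        · exact hlS v hv
        · rw [List.mem_singleton] at hv
          exact hv ▸ hw
      · rw [List.length_append, hlen]; rfl
    have haS : a ∈ S := hlS a (by simp)
    have hbS : b ∈ S := hlS b (by rw [hlb]; simp)
    -- The end degrees sum to at least `m + 1`, hence to at least the length of the list.
    obtain ⟨l₁, x, y, l₂, hsplit, hbx, hay⟩ :=
      List.exists_split_of_le_countP (G.Adj a ·) (G.Adj b ·) (a :: l') hne (by
        have h1 := hlow a haS
        have h2 := hlow b hbS
        omega)
    simp only [decide_eq_true_eq] at hbx hay
    have hcyc := isChain_crossing (G := G) (a := a) (b := b) (hsplit ▸ hch)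
      (hsplit ▸ rfl) (by rw [← hsplit, hlb]; simp) hay hbx
    set c := (l₁ ++ [x]) ++ (y :: l₂).reverse with hcdef
    have hperm : c.Perm (a :: l') := by
      rw [hsplit, hcdef]
      refine ((List.reverse_perm _).append_left _).trans ?_
      simp
    have hclosed : ∀ v ∈ (a :: l').toFinset, ∀ w ∈ S \ (a :: l').toFinset, ¬ G.Adj v w := by
      intro v hv w hw hvw
      rw [mem_sdiff, List.mem_toFinset] at hw
      rw [List.mem_toFinset] at hv
      obtain ⟨c₁, c₂, hc12⟩ := List.append_of_mem (hperm.mem_iff.2 hv)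
      rw [hc12] at hcyc hperm
      have hperm' : (v :: (c₂ ++ c₁)).Perm (a :: l') :=
        List.perm_append_comm.trans hperm
      have := hmax (p + 1) ⟨w :: v :: (c₂ ++ c₁),
        exists_isChain_longer hcyc.1 hcyc.2 hvw.symm, ?_, ?_, ?_⟩
      · omega
      · exact List.nodup_cons.2 ⟨fun hw' ↦ hw.2 (hperm'.mem_iff.1 hw'), hperm'.nodup_iff.2 hnd⟩
      · intro u hu
        rcases List.mem_cons.1 hu with rfl | hu
        exacts [hw.1, hlS u (hperm'.mem_iff.1 hu)]
      · rw [List.length_cons, hperm'.length_eq, hlen]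
    have hTS : (a :: l').toFinset ⊆ S := fun v hv ↦ hlS v (List.mem_toFinset.1 hv)
    have hTcard : #(a :: l').toFinset = p := by
      rw [List.toFinset_card_of_nodup hnd, hlen]
    set T := (a :: l').toFinset
    rw [G.edgeCount_self_of_not_adj hTS hclosed]
    have hcard := card_sdiff_add_card_eq_card hTS
    -- `T` is cut off from the rest of `S` and has `p ≤ m + 1` vertices, so degrees in it are at
    -- most `m`.
    have h1 : G.edgeCount T T ≤ m * p := by
      have : G.edgeCount T T ≤ #T • (p - 1) :=
        sum_le_card_nsmul T _ _ fun v hv ↦ hTcard ▸ G.degIn_le_card_pred hv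
      rw [hTcard, smul_eq_mul] at this
      refine this.trans ?_
      rw [mul_comm]
      exact Nat.mul_le_mul_right _ (by omega)
    have h2 := ih _ (by omega) (S \ T)
      (fun l h1 h2 h3 ↦ h l h1 h2 fun w hw ↦ (mem_sdiff.1 (h3 w hw)).1) rfl
    rw [← hcard, hTcard]
    linarith

/-- In a bipartite pair `(X, Y)` whose degrees exceed `k`, a path can be extended at an end in `X`
to a path alternating between `X` and `Y`. -/
lemma exists_alternating_path {k : ℕ} {X Y : Finset V}
    (hX : ∀ x ∈ X, k < G.degIn x Y) (hY : ∀ y ∈ Y, k < G.degIn y X) {N : Finset V} (hXN : X ⊆ N)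
    (hNY : Disjoint N Y) {x z : V} {l : List V} (hx : x ∈ X)
    (hch : (x :: l).IsChain G.Adj) (hnd : (x :: l).Nodup) (hlN : ∀ v ∈ x :: l, v ∈ N)
    (hz : (x :: l).getLast? = some z) (j : ℕ) (hj : l.length + j ≤ k) :
    ∃ x' ∈ X, ∃ l' : List V, (x' :: l').IsChain G.Adj ∧ (x' :: l').Nodup ∧
      (∀ v ∈ x' :: l', v ∈ N ∪ Y) ∧ (x' :: l').getLast? = some z ∧
      #((x' :: l').toFinset ∩ N) ≤ l.length + 1 + j ∧ #((x' :: l').toFinset ∩ Y) ≤ j ∧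
      l'.length = l.length + 2 * j := by
  induction j with
  | zero =>
    refine ⟨x, hx, l, hch, hnd, fun v hv ↦ mem_union_left _ (hlN v hv), hz, ?_, ?_, rfl⟩
    · exact (card_le_card inter_subset_left).trans (List.toFinset_card_le _)
    · rw [Nat.le_zero, card_eq_zero, ← disjoint_iff_inter_eq_empty]
      exact hNY.mono_left fun v hv ↦ hlN v (List.mem_toFinset.1 hv)
  | succ j ih =>
    obtain ⟨x', hx', l', hch', hnd', hl', hz', hcN, hcY, hlen⟩ := ih (by omega)
    -- The path uses at most `k` vertices of `Y`, and likewise of `N` below, so a fresh neighbour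
    -- exists each time.
    obtain ⟨y, hy, hyl⟩ : ∃ y ∈ {w ∈ Y | G.Adj x' w}, y ∉ (x' :: l').toFinset ∩ Y := by
      by_contra! hcon
      have := card_le_card hcon
      have := hX x' hx'
      unfold degIn at this
      omega
    rw [mem_filter] at hy
    have hyl' : y ∉ x' :: l' := fun h ↦ hyl (mem_inter.2 ⟨List.mem_toFinset.2 h, hy.1⟩)
    obtain ⟨w, hw, hwl⟩ : ∃ w ∈ {w ∈ X | G.Adj y w}, w ∉ (x' :: l').toFinset ∩ N := by
      by_contra! hcon
      have := card_le_card hcon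
      have := hY y hy.1
      unfold degIn at this
      omega
    rw [mem_filter] at hw
    have hwN := hXN hw.1
    have hwl' : w ∉ x' :: l' := fun h ↦ hwl (mem_inter.2 ⟨List.mem_toFinset.2 h, hwN⟩)
    have hyN : y ∉ N := fun h ↦ Finset.disjoint_left.1 hNY h hy.1
    have hwY : w ∉ Y := Finset.disjoint_left.1 hNY hwN
    refine ⟨w, hw.1, y :: x' :: l', ?_, ?_, ?_, ?_, ?_, ?_, ?_⟩
    · exact List.isChain_cons_cons.2 ⟨hw.2.symm, List.isChain_cons_cons.2 ⟨hy.2.symm, hch'⟩⟩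
    · refine List.nodup_cons.2 ⟨?_, List.nodup_cons.2 ⟨hyl', hnd'⟩⟩
      rw [List.mem_cons, not_or]
      exact ⟨hw.2.ne', hwl'⟩
    · intro v hv
      rcases List.mem_cons.1 hv with rfl | hv
      · exact mem_union_left _ hwN
      rcases List.mem_cons.1 hv with rfl | hv
      · exact mem_union_right _ hy.1
      · exact hl' v hv
    · simpa [List.getLast?_cons_cons] using hz'
    · rw [List.toFinset_cons, List.toFinset_cons (a := y), insert_inter_of_mem hwN,
        insert_inter_of_notMem hyN]
      have := card_insert_le w ((x' :: l').toFinset ∩ N)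
      omega
    · rw [List.toFinset_cons, List.toFinset_cons (a := y), insert_inter_of_notMem hwY,
        insert_inter_of_mem hy.1]
      have := card_insert_le y ((x' :: l').toFinset ∩ Y)
      omega
    · simp only [List.length_cons, hlen]; ring

end Paths
-- Two-walks in graphs without a `t`-cycle
section CycleFree

variable {V : Type*} [Fintype V] [DecidableEq V] {G : SimpleGraph V} [DecidableRel G.Adj]

/-- If `7 * t ≤ n` and `G` has no `t`-cycle, then `G` has at most `n ^ 2 / 4` walks of length two
starting at a given vertex. -/
theorem four_mul_edgeCount_neighbors_le {t : ℕ} (ht : 3 ≤ t) (htn : 7 * t ≤ Fintype.card V)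
    (hG : ¬ G.ContainsCycleOfLength t) (u : V) :
    4 * G.edgeCount {v | G.Adj u v} univ ≤ Fintype.card V ^ 2 := by
  set N : Finset V := {v | G.Adj u v} with hN
  have hmemN : ∀ v, v ∈ N ↔ G.Adj u v := fun v ↦ by simp [hN]
  have huN : u ∉ N := fun h ↦ G.irrefl ((hmemN u).1 h)
  have huc : u ∈ univ \ N := by simpa using huN
  set W := (univ \ N).erase u with hW
  have hNW : Disjoint N W := disjoint_sdiff.mono_right (erase_subset _ _)
  have huNW : u ∉ N ∪ W := by simp [huN, hW]
  -- Threshold `t / 2` permits `t / 2 - 1` double steps from a start of at most two vertices.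
  obtain ⟨X, hXN, Y, hYW, hX, hY, hcore⟩ := G.exists_core (t / 2) N W
  have hcycle : ∀ x z : V, ∀ l : List V, (x :: l).IsChain G.Adj → (x :: l).Nodup →
      (∀ v ∈ x :: l, v ∈ N ∪ W) → (x :: l).getLast? = some z → x ∈ N → z ∈ N →
      l.length + 2 ≠ t := by
    rintro x z l hch hnd hl hz hx hzN rfl
    exact hG (containsCycleOfLength_of_isChain hch hnd hz ((hmemN x).1 hx) ((hmemN z).1 hzN)
      (fun h ↦ huNW (hl u h)) (by omega))
  have hNY : Disjoint N Y := hNW.mono_right hYW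
  have hXadj : ∀ x ∈ X, ∀ y ∈ N, ¬ G.Adj x y := by
    intro x hx y hy hxy
    have hlong : ∀ l : List V, l.length + 1 ≤ 2 → l.length + 2 * (t / 2 - 1) + 2 = t →
        (x :: l).IsChain G.Adj → (x :: l).Nodup → (∀ v ∈ x :: l, v ∈ N) → False := by
      intro l hl2 hlt hch hnd hlN
      obtain ⟨z, hz⟩ : ∃ z, (x :: l).getLast? = some z :=
        ⟨_, List.getLast?_eq_some_getLast (by simp)⟩
      obtain ⟨x', hx', l', hch', hnd', hl', hz', -, -, hlen⟩ :=
        exists_alternating_path hX hY hXN hNY hx hch hnd hlN hz (t / 2 - 1) (by omega)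
      exact hcycle x' z l' hch' hnd'
        (fun v hv ↦ union_subset_union_right hYW (hl' v hv)) hz' (hXN hx')
        (hlN z (List.mem_of_getLast? hz)) (by omega)
    -- Each double step adds two vertices. To reach `t - 1`, even `t` starts from `x` alone (so `X`
    -- is in fact empty), while odd `t` needs the edge `xy`.
    rcases Nat.even_or_odd t with ⟨k, hk⟩ | ⟨k, hk⟩
    · exact hlong [] (by simp) (by simp; omega) (by simp) (by simp) (by simpa using hXN hx)
    · exact hlong [y] (by simp) (by simp; omega) (by simpa using hxy) (by simpa using hxy.ne)
        (by simpa using ⟨hXN hx, hy⟩)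
  have hN : G.edgeCount N N = G.edgeCount (N \ X) (N \ X) := by
    rw [G.edgeCount_self_of_not_adj hXN fun x hx y hy ↦ hXadj x hx y (mem_sdiff.1 hy).1,
      G.edgeCount_eq_zero fun x hx y hy ↦ hXadj x hx y (hXN hy), zero_add]
  have hR : G.edgeCount (N \ X) (N \ X) ≤ (t - 3) * #(N \ X) := by
    refine edgeCount_le_of_no_path _ _ fun l hch hnd hl ↦ ?_
    by_contra! hlen
    have hlen' : (l.take (t - 1)).length = t - 1 := by
      rw [List.length_take]; omega
    have hsub : ∀ v ∈ l.take (t - 1), v ∈ N := fun v hv ↦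
      (mem_sdiff.1 (hl v (List.mem_of_mem_take hv))).1
    have hch' := hch.take (t - 1)
    have hnd' := hnd.sublist (List.take_sublist (t - 1) l)
    obtain ⟨x, l', hxl⟩ := List.exists_cons_of_ne_nil
      (List.ne_nil_of_length_pos (l := l.take (t - 1)) (by omega))
    rw [hxl] at hlen' hsub hch' hnd'
    have hz := List.getLast?_eq_some_getLast (l := x :: l') (by simp)
    refine hcycle x _ l' hch' hnd' (fun v hv ↦ mem_union_left _ (hsub v hv)) hz
      (hsub x (by simp)) (hsub _ (List.mem_of_getLast? hz)) ?_
    rw [List.length_cons] at hlen'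
    omega
  have htotal : G.edgeCount N univ = G.edgeCount N N + G.edgeCount N W + G.degIn u N := by
    rw [G.edgeCount_sdiff_right N (subset_univ N), G.edgeCount_erase_right N huc, add_assoc]
  have hu := G.degIn_le_card u N
  have hXY := G.edgeCount_le_mul X Y
  have hcN := card_sdiff_add_card_eq_card hXN
  have hcW := card_sdiff_add_card_eq_card hYW
  have hn : Fintype.card V = #N + #W + 1 := by
    have h1 := card_sdiff_add_card_eq_card (subset_univ N)
    have h2 : #W + 1 = #(univ \ N) := card_erase_add_one huc
    rw [card_univ] at h1
    omega
  rw [hN] at htotal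
  generalize G.edgeCount N univ = D at *
  generalize G.edgeCount (N \ X) (N \ X) = E₁ at *
  generalize G.edgeCount N W = E₂ at *
  generalize G.edgeCount X Y = E₃ at *
  generalize #(N \ X) = r at *
  generalize #(W \ Y) = s at *
  generalize #X = a at *
  generalize #Y = b at *
  -- The left side is at most `6t - 8`, so `7t ≤ n` is ample.
  have hk : 4 * (t - 2 + t / 2) ≤ Fintype.card V := by omega
  generalize t / 2 = k at *
  obtain ⟨m, rfl⟩ : ∃ m, t = m + 3 := ⟨t - 3, by omega⟩
  rw [show m + 3 - 3 = m by omega] at hR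
  rw [show m + 3 - 2 = m + 1 by omega] at hk
  rw [hn, ← hcN, ← hcW] at hk ⊢
  rw [← hcN, ← hcW] at hcore
  rw [← hcN] at hu
  have hD : D ≤ m * r + (k * (r + s) + a * b) + (r + a) := by linarith
  have hq := Nat.mul_le_mul_right (r + s) hk
  zify at hD hq ⊢
  -- `4D ≤ n(r + s) + 4a(b + 1) ≤ n(r + s) + (a + b + 1)² ≤ n²`, as `n = (r + s) + (a + b + 1)`.
  nlinarith [sq_nonneg ((a : ℤ) - b - 1), mul_nonneg (Nat.cast_nonneg (α := ℤ) s)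
    (Nat.cast_nonneg (α := ℤ) m)]

end CycleFree
-- From the spectral radius to two-walks
section Spectral

variable {V : Type*} [Fintype V] [DecidableEq V]

lemma mem_spectrum_adjMatrix_iff (G : SimpleGraph V) [DecidableRel G.Adj] (μ : ℝ) :
    μ ∈ spectrum ℝ (G.adjMatrix ℝ) ↔
      ∃ x : V → ℝ, x ≠ 0 ∧ ∀ v, ∑ w ∈ G.neighborFinset v, x w = μ * x v := by
  rw [← Matrix.spectrum_toLin', ← Module.End.hasEigenvalue_iff_mem_spectrum]
  constructor
  · intro h
    obtain ⟨x, hx⟩ := h.exists_hasEigenvector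
    refine ⟨x, hx.2, fun v ↦ ?_⟩
    simpa [adjMatrix_mulVec_apply] using congrFun hx.apply_eq_smul v
  · rintro ⟨x, hx, h⟩
    refine Module.End.hasEigenvalue_of_hasEigenvector (x := x)
      ⟨Module.End.mem_eigenspace_iff.2 (funext fun v ↦ ?_), hx⟩
    simpa [adjMatrix_mulVec_apply] using h v

/-- The square of an eigenvalue is at most the number of walks of length two from some vertex. -/
lemma exists_sq_le_edgeCount {G : SimpleGraph V} [DecidableRel G.Adj] {μ : ℝ}
    (hμ : μ ∈ spectrum ℝ (G.adjMatrix ℝ)) :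
    ∃ u, μ ^ 2 ≤ G.edgeCount {v | G.Adj u v} univ := by
  obtain ⟨x, hx, h⟩ := (G.mem_spectrum_adjMatrix_iff μ).1 hμ
  obtain ⟨v₀, hv₀⟩ := Function.ne_iff.1 hx
  obtain ⟨u, -, hu⟩ := exists_max_image univ (fun v ↦ |x v|) ⟨v₀, mem_univ _⟩
  have hpos : 0 < |x u| := (abs_pos.2 hv₀).trans_le (hu v₀ (mem_univ _))
  refine ⟨u, le_of_mul_le_mul_right ?_ hpos⟩
  have key : ∀ v, |μ| * |x v| ≤ ∑ w ∈ G.neighborFinset v, |x w| := fun v ↦ by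
    rw [← abs_mul, ← h v]
    exact abs_sum_le_sum_abs _ _
  have key' : ∀ v, |μ| * |x v| ≤ G.degIn v univ * |x u| := fun v ↦ by
    refine (key v).trans ?_
    refine (sum_le_card_nsmul _ _ _ fun w _ ↦ hu w (mem_univ _)).trans_eq ?_
    rw [nsmul_eq_mul, degIn, neighborFinset_eq_filter]
  calc μ ^ 2 * |x u| = |μ| * (|μ| * |x u|) := by rw [← sq_abs]; ring
    _ ≤ |μ| * ∑ w ∈ G.neighborFinset u, |x w| := by gcongr; exact key u
    _ = ∑ w ∈ G.neighborFinset u, |μ| * |x w| := mul_sum _ _ _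
    _ ≤ ∑ w ∈ G.neighborFinset u, G.degIn w univ * |x u| := sum_le_sum fun w _ ↦ key' w
    _ = G.edgeCount {v | G.Adj u v} univ * |x u| := by
      rw [← sum_mul, edgeCount, neighborFinset_eq_filter, Nat.cast_sum]

lemma card_filter_fin_mod_two (n : ℕ) :
    #{i : Fin n | (i : ℕ) % 2 = 0} = (n + 1) / 2 ∧ #{i : Fin n | (i : ℕ) % 2 = 1} = n / 2 := by
  simp only [card_filter]
  rw [Fin.sum_univ_eq_sum_range (fun i ↦ if i % 2 = 0 then 1 else 0) n,
    Fin.sum_univ_eq_sum_range (fun i ↦ if i % 2 = 1 then 1 else 0) n]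
  induction n with
  | zero => simp
  | succ n ih =>
    rw [sum_range_succ, sum_range_succ, ih.1, ih.2]
    split_ifs <;> omega

lemma sqrt_mem_spectrum_turanGraph_two {n : ℕ} (hn : 2 ≤ n) :
    √(((n + 1) / 2 : ℕ) * (n / 2 : ℕ)) ∈ spectrum ℝ ((turanGraph n 2).adjMatrix ℝ) := by
  obtain ⟨h0, h1⟩ := card_filter_fin_mod_two n
  set p : ℕ := (n + 1) / 2
  set q : ℕ := n / 2
  rw [mem_spectrum_adjMatrix_iff]
  -- Even residues form the part of size `p`. The assumption `2 ≤ n` gives `q > 0`, so the entry at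
  -- `0` is nonzero.
  refine ⟨fun i ↦ if (i : ℕ) % 2 = 0 then √q else √p, ?_, fun i ↦ ?_⟩
  · refine Function.ne_iff.2 ⟨⟨0, by omega⟩, ?_⟩
    have : 0 < q := by omega
    simpa using this.ne'
  · rw [Real.sqrt_mul (by positivity)]
    have hp := Real.mul_self_sqrt (Nat.cast_nonneg (α := ℝ) p)
    have hq := Real.mul_self_sqrt (Nat.cast_nonneg (α := ℝ) q)
    rw [neighborFinset_eq_filter]
    rcases Nat.mod_two_eq_zero_or_one i with hi | hi
    · have hf : univ.filter ((turanGraph n 2).Adj i) = univ.filter fun j : Fin n ↦ (j : ℕ) % 2 = 1 := by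
        ext j
        simp only [mem_filter, mem_univ, true_and, turanGraph_adj, hi]
        omega
      rw [hf, sum_congr rfl (g := fun _ ↦ √(p : ℝ)), sum_const, h1, nsmul_eq_mul]
      · simp only [hi, if_true]
        linear_combination (-√(p : ℝ)) * hq
      · intro j hj
        rw [mem_filter] at hj
        simp [hj.2]
    · have hf : univ.filter ((turanGraph n 2).Adj i) = univ.filter fun j : Fin n ↦ (j : ℕ) % 2 = 0 := by
        ext j
        simp only [mem_filter, mem_univ, true_and, turanGraph_adj, hi]
        omega
      rw [hf, sum_congr rfl (g := fun _ ↦ √(q : ℝ)), sum_const, h0, nsmul_eq_mul]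
      · simp only [hi, one_ne_zero, if_false]
        linear_combination (-√(q : ℝ)) * hp
      · intro j hj
        rw [mem_filter] at hj
        simp [hj.2]

/-- A graph whose spectral radius exceeds that of `T_{n,2}` has a vertex starting more than
`⌊n / 2⌋ * ⌈n / 2⌉` walks of length two. -/
lemma exists_lt_edgeCount {G : SimpleGraph V} [DecidableRel G.Adj] {n : ℕ} (hn : 2 ≤ n)
    (hG : (turanGraph n 2).specRadius < G.specRadius) :
    ∃ u, (n + 1) / 2 * (n / 2) < G.edgeCount {v | G.Adj u v} univ := by
  have h1 : (‖√(((n + 1) / 2 : ℕ) * (n / 2 : ℕ))‖₊ : ENNReal) ≤ (turanGraph n 2).specRadius :=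
    le_iSup₂ (f := fun (k : ℝ) (_ : k ∈ spectrum ℝ ((turanGraph n 2).adjMatrix ℝ)) ↦
      (‖k‖₊ : ENNReal)) _ (sqrt_mem_spectrum_turanGraph_two hn)
  have h2 := h1.trans_lt hG
  simp only [specRadius, spectralRadius, lt_iSup_iff] at h2
  obtain ⟨μ, hμ, h3⟩ := h2
  rw [ENNReal.coe_lt_coe, ← NNReal.coe_lt_coe, coe_nnnorm, coe_nnnorm, Real.norm_eq_abs,
    Real.norm_eq_abs, ← sq_lt_sq, Real.sq_sqrt (by positivity)] at h3
  obtain ⟨u, hu⟩ := exists_sq_le_edgeCount hμ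
  refine ⟨u, ?_⟩
  exact_mod_cast h3.trans_le hu

end Spectral
end SimpleGraph

theorem corollary1p2 {V : Type*} [Fintype V] [DecidableEq V] (G : SimpleGraph V)
    [DecidableRel G.Adj] (n : ℕ) (hn : Fintype.card V = n)
    (hG : (SimpleGraph.turanGraph n 2).specRadius < G.specRadius)
    (t : ℕ) (ht : 3 ≤ t) (htn : (t : ℝ) ≤ (n : ℝ) / 7) :
    G.ContainsCycleOfLength t := by
  have htn' : 7 * t ≤ n := by
    rw [le_div_iff₀ (by norm_num)] at htn
    have : t * 7 ≤ n := by exact_mod_cast htn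
    omega
  by_contra hcon
  obtain ⟨u, hu⟩ := SimpleGraph.exists_lt_edgeCount (by omega) hG
  have h := SimpleGraph.four_mul_edgeCount_neighbors_le ht (hn.symm ▸ htn') hcon u
  rw [hn] at h
  -- For odd `n`, `n²/4 = m(m + 1) + 1/4`, so integrality of the count is needed.
  obtain ⟨m, rfl | rfl⟩ := Nat.even_or_odd' n
  · rw [show (2 * m + 1) / 2 = m by omega, show 2 * m / 2 = m by omega] at hu
    nlinarith
  · rw [show (2 * m + 1 + 1) / 2 = m + 1 by omega, show (2 * m + 1) / 2 = m by omega] at hu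
    nlinarith
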